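/- For sequences $(a_n)_{n\ge 0}$, $(b_n)_{n\ge 1}$ of complex numbers, let $$\mathrm{CF}[a_n,b_n]=a_0+\cfrac{b_1}{a_1+\cfrac{b_2}{a_2+\ddots}}$$ denote the value of the infinite continued fraction, i.e. $\lim_{n\to\infty}A_n/B_n$, where $A_0=1$, $A_1=a_0$, $B_0=0$, $B_1=1$ and $y_{n+1}=a_ny_n+b_ny_{n-1}$ $(n\ge 1)$ for $y=A$ and $y=B$. Let $\Delta f_n=f_{n+1}-f_n$, and for complex numbers $\alpha,\beta,\gamma$ put $$H(\alpha,\beta;\gamma)=\frac{1}{\mathrm{CF}\bigl[\Delta\bigl(n(n+\alpha)(n+\beta)\bigr),\,-2n(n+\alpha)(n+\beta)(n+\gamma)\bigr]}$$ whenever this continued fraction converges to a nonzero number. **Theorem.** For all non-negative integers $p$ and $q$, the continued fractions defining $H(2p,0;q)$ and $H(2q,0;p)$ converge to nonzero complex numbers, so that both sides below are well defined, and $$H(2p,0;q)=H(2q,0;p).$$ -/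

import Mathlib

open Filter Topology

namespace RamanujanCF

/-- The infinite continued fraction `CF[a_n, b_n] = a 0 + b 1 / (a 1 + b 2 / (a 2 + ⋯))`, as a
Mathlib generalized continued fraction. The value `b 0` is not used. -/
def CF (a b : ℕ → ℂ) : GenContFract ℂ where
  h := a 0
  s := ⟨fun n => some ⟨b (n + 1), a (n + 1)⟩, fun h => by simp at h⟩

/-- The infinite continued fraction `g` converges to the complex number `v`: from some index on its
convergents have nonzero denominators, and the convergents tend to `v`. -/
def ConvergesTo (g : GenContFract ℂ) (v : ℂ) : Prop :=
  (∀ᶠ n in atTop, g.dens n ≠ 0) ∧ Tendsto (fun n => g.convs n) atTop (𝓝 v)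

/-- The value of a continued fraction, i.e. the limit of its convergents (only meaningful when the
continued fraction converges). -/
noncomputable def value (g : GenContFract ℂ) : ℂ :=
  limUnder atTop (fun n => g.convs n)

theorem ConvergesTo.value_eq {g : GenContFract ℂ} {v : ℂ} (h : ConvergesTo g v) : value g = v :=
  h.2.limUnder_eq

/-- The continued fraction `CF[Δ(n(n+α)(n+β)), -2n(n+α)(n+β)(n+γ)]`, where `Δ f n = f (n+1) - f n`. -/
noncomputable def cfH (α β γ : ℂ) : GenContFract ℂ :=
  CF (fwdDiff 1 fun n : ℕ => (n : ℂ) * (n + α) * (n + β))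
    (fun n : ℕ => -2 * (n : ℂ) * (n + α) * (n + β) * (n + γ))

/-- The function `H(α, β; γ) = 1 / CF[Δ(n(n+α)(n+β)), -2n(n+α)(n+β)(n+γ)]` of three complex
variables (meaningful where that continued fraction converges to a nonzero number). -/
noncomputable def H (α β γ : ℂ) : ℂ :=
  1 / value (cfH α β γ)

end RamanujanCF

/-! Write `S(s)` for `series q d s`, the sum over `k ≥ 0` of `Γ(k-q+1/2) Γ(k+d+1/2)² 4^k / (k!
(2k+2d+s)!)`, with `d = p - q`. Creative telescoping gives a three-term recurrence in `s`, which
says exactly that `M n = n!² (n+2p)! S(n+1)` (`minimalSol`) solves the recurrence of the continued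
fraction of `H(2p,0;q)`. This solution is negligible against the denominators of the convergents, so
Pincherle's theorem (`CF_convergesTo`) gives the value `a 0 - M 1 / M 0`. Hence `H(2p,0;q) = S(1) /
((1+2p)(S(1) - S(2)))`, which is `seriesRatio p q`.

The symmetry of this ratio comes from contiguous relations in `q` and `d`, again proved by
telescoping. The difference `S(1) - S(2)` obeys first-order relations, so dividing by it keeps the
relations for `S(1)` explicit. After division, the relation along `p` and the one along `q` are
exchanged by swapping `p` and `q`, and so are the two boundary recurrences. Induction on `p + q`
then gives `seriesRatio_comm`.

Pincherle's theorem also needs `S(1) ≠ 0`. For `q ≤ p` this follows from a monotonicity argument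
(`series_ne_zero_of_le`); symmetry transfers it to `p < q`. -/

namespace RamanujanCF

/-! ### Half-integer Gamma values and reciprocal factorials -/

/-- The values of the Gamma function at half-integers. -/
noncomputable def halfGamma (j : ℤ) : ℝ := Real.Gamma (j + 1 / 2)

/-- The reciprocal factorial, extended by zero to negative integers. -/
noncomputable def invFact (j : ℤ) : ℝ := (Real.Gamma (j + 1))⁻¹

theorem half_int_ne_zero (j : ℤ) : (j : ℝ) + 1 / 2 ≠ 0 := by
  intro h
  have h2 : ((2 * j + 1 : ℤ) : ℝ) = 0 := by push_cast; linarith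
  have h3 : 2 * j + 1 = 0 := by exact_mod_cast h2
  omega

theorem halfGamma_add_one (j : ℤ) : halfGamma (j + 1) = (j + 1 / 2) * halfGamma j := by
  unfold halfGamma
  rw [← Real.Gamma_add_one (half_int_ne_zero j)]
  congr 1; push_cast; ring

theorem halfGamma_ne_zero (j : ℤ) : halfGamma j ≠ 0 := by
  refine Real.Gamma_ne_zero fun m h => half_int_ne_zero (j + m) ?_
  push_cast; linarith

theorem halfGamma_pos (j : ℕ) : 0 < halfGamma j := by
  refine Real.Gamma_pos_of_pos ?_
  push_cast; positivity

/-- No sign condition is needed: Mathlib's `Gamma` is `0` at its poles and `0⁻¹ = 0`, which agrees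
with the zeros of `1/Γ`. The shifts of the summand therefore need no case distinction. -/
theorem invFact_eq (j : ℤ) : invFact j = (j + 1) * invFact (j + 1) := by
  unfold invFact
  by_cases h : (j : ℝ) + 1 = 0
  · simp [h]
  · push_cast
    rw [Real.Gamma_add_one h]
    field_simp

theorem invFact_natCast (n : ℕ) : invFact n = ((n.factorial : ℝ))⁻¹ := by
  simp [invFact, Real.Gamma_nat_eq_factorial]

theorem invFact_of_neg {j : ℤ} (h : j < 0) : invFact j = 0 := by
  obtain ⟨m, hm⟩ : ∃ m : ℕ, j + 1 = -(m : ℤ) := ⟨(-(j + 1)).toNat, by omega⟩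
  have : (j : ℝ) + 1 = -(m : ℝ) := by exact_mod_cast hm
  simp [invFact, this, Real.Gamma_neg_nat_eq_zero]

theorem invFact_nonneg (j : ℤ) : 0 ≤ invFact j := by
  rcases lt_or_ge j 0 with h | h
  · rw [invFact_of_neg h]
  · lift j to ℕ using h
    rw [invFact_natCast]; positivity

theorem invFact_pos {j : ℤ} (h : 0 ≤ j) : 0 < invFact j := by
  lift j to ℕ using h
  rw [invFact_natCast]; positivity

/-! ### The hypergeometric summand and its shifts -/

/-- The terms of the series giving the minimal solution of the three-term recurrence. -/
noncomputable def summand (q d s : ℤ) (k : ℕ) : ℝ :=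
  halfGamma (k - q) * halfGamma (k + d) ^ 2 * 4 ^ k * invFact k * invFact (2 * (k + d) + s)

theorem summand_shift_s (q d s : ℤ) (k : ℕ) :
    summand q d s k = (2 * (k + d) + s + 1) * summand q d (s + 1) k := by
  unfold summand
  rw [invFact_eq (2 * (k + d) + s), ← add_assoc]
  push_cast; ring

theorem summand_shift_q (q d s : ℤ) (k : ℕ) :
    summand (q - 1) d s k = (k - q + 1 / 2) * summand q d s k := by
  unfold summand
  rw [show (k : ℤ) - (q - 1) = k - q + 1 by ring, halfGamma_add_one]
  push_cast; ring

theorem summand_shift_d (q d s : ℤ) (k : ℕ) :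
    summand q (d + 1) s k = (k + d + 1 / 2) ^ 2 * summand q d (s + 2) k := by
  unfold summand
  rw [show (k : ℤ) + (d + 1) = k + d + 1 by ring, halfGamma_add_one,
    show 2 * ((k : ℤ) + d + 1) + s = 2 * (k + d) + (s + 2) by ring]
  push_cast; ring

theorem summand_succ (q d s : ℤ) (k : ℕ) :
    (k + 1) * summand q d s (k + 1) =
      4 * (k - q + 1 / 2) * (k + d + 1 / 2) ^ 2 * summand q d (s + 2) k := by
  unfold summand
  rw [invFact_eq (k : ℤ)]
  push_cast
  rw [show (k : ℤ) + 1 - q = k - q + 1 by ring, show (k : ℤ) + 1 + d = k + d + 1 by ring,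
    halfGamma_add_one, halfGamma_add_one,
    show 2 * ((k : ℤ) + d + 1) + s = 2 * (k + d) + (s + 2) by ring]
  push_cast; ring

/-! ### Summability and telescoping -/

/-- A form of Raabe's test. -/
theorem summable_of_raabe {a : ℕ → ℝ}
    (h : ∀ᶠ k : ℕ in atTop, k * |a (k + 1)| ≤ (k - 3 / 2) * |a k|) : Summable a := by
  obtain ⟨N, hN⟩ := eventually_atTop.1 h
  rw [← summable_nat_add_iff (N + 1)]
  refine Summable.of_abs (summable_of_sum_range_le (c := 2 * (N * |a (N + 1)|))
    (fun _ => abs_nonneg _) fun n => ?_)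
  -- The hypothesis rearranges to `|a k| ≤ 2 ((k-1)|a k| - k |a (k+1)|)`, whose right side
  -- telescopes.
  have key : ∀ n : ℕ, ∑ i ∈ Finset.range n, |a (i + (N + 1))| ≤
      2 * (N * |a (N + 1)|) - 2 * ((n + N) * |a (n + (N + 1))|) := by
    intro n
    induction n with
    | zero => simp
    | succ n ih =>
      rw [Finset.sum_range_succ]
      have := hN (n + (N + 1)) (by omega)
      rw [show n + 1 + (N + 1) = n + (N + 1) + 1 by ring]
      push_cast at this ⊢
      linarith
  have h0 : 0 ≤ ((n : ℝ) + N) * |a (n + (N + 1))| := by positivity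
  linarith [key n]

/-- The partial sums are `n * s n`. If they had a nonzero limit, `|s n|` would eventually exceed a
multiple of `1/n`, against summability. Thus a telescoping certificate only has to be summable, with
no separate decay estimate. -/
theorem tsum_telescope_eq_zero {s : ℕ → ℝ} (hs : Summable s)
    (hF : Summable fun k : ℕ => ((k : ℝ) + 1) * s (k + 1) - k * s k) :
    ∑' k : ℕ, (((k : ℝ) + 1) * s (k + 1) - k * s k) = 0 := by
  set L := ∑' k : ℕ, (((k : ℝ) + 1) * s (k + 1) - k * s k) with hL
  have hlim : Tendsto (fun n : ℕ => (n : ℝ) * s n) atTop (𝓝 L) := by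
    have := hF.hasSum.tendsto_sum_nat
    refine this.congr fun n => ?_
    have := Finset.sum_range_sub (fun k : ℕ => (k : ℝ) * s k) n
    simp only [Nat.cast_add, Nat.cast_one, Nat.cast_zero, zero_mul, sub_zero] at this
    exact this
  by_contra hne
  have hpos : 0 < |L| := abs_pos.2 hne
  have hev : ∀ᶠ n : ℕ in atTop, |L| / 2 < |(n : ℝ) * s n| :=
    hlim.abs.eventually (lt_mem_nhds (by linarith))
  refine Real.not_summable_one_div_natCast ?_
  refine Summable.of_norm_bounded_eventually_nat (hs.abs.mul_left (2 / |L|)) ?_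
  filter_upwards [hev, eventually_gt_atTop 0] with n hn hn0
  have hn0' : (0 : ℝ) < n := by exact_mod_cast hn0
  rw [abs_mul, abs_of_pos hn0'] at hn
  rw [Real.norm_of_nonneg (by positivity), div_le_iff₀ hn0']
  have : 2 / |L| * (|L| / 2) ≤ 2 / |L| * (n * |s n|) := by gcongr
  have h1 : 2 / |L| * (|L| / 2) = 1 := by field_simp
  nlinarith

theorem HasSum.eq_zero_of_telescope {F s : ℕ → ℝ} {L : ℝ} (hF : HasSum F L) (hs : Summable s)
    (h : ∀ k : ℕ, F k = ((k : ℝ) + 1) * s (k + 1) - k * s k) : L = 0 := by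
  obtain rfl : F = fun k : ℕ => ((k : ℝ) + 1) * s (k + 1) - k * s k := funext h
  rw [← hF.tsum_eq, tsum_telescope_eq_zero hs hF.summable]

/-- The ratio of consecutive terms is `1 - (q+s+1)/k + O(1/k²)`, and `q + s + 1 ≥ 2` leaves room
above the `3/2` of the Raabe test. -/
theorem summable_summand {q d s : ℤ} (hq : 0 ≤ q) (hs : 1 ≤ s) : Summable (summand q d s) := by
  refine summable_of_raabe ?_
  have hq' : (0 : ℝ) ≤ q := by exact_mod_cast hq
  have hs' : (1 : ℝ) ≤ s := by exact_mod_cast hs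
  filter_upwards [eventually_ge_atTop (⌈4 * (|(d : ℝ)| + 2) ^ 2⌉₊ + ⌈(q : ℝ)⌉₊)] with k hk
  have hk1 : 4 * (|(d : ℝ)| + 2) ^ 2 + q ≤ k := by
    have h1 := Nat.le_ceil (4 * (|(d : ℝ)| + 2) ^ 2)
    have h2 := Nat.le_ceil (q : ℝ)
    have : ((⌈4 * (|(d : ℝ)| + 2) ^ 2⌉₊ + ⌈(q : ℝ)⌉₊ : ℕ) : ℝ) ≤ k := by exact_mod_cast hk
    push_cast at this
    linarith
  set x : ℝ := (k : ℝ)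
  set e : ℝ := (d : ℝ)
  have he := abs_nonneg e
  have hx : 16 ≤ x := by nlinarith
  have hde : -|e| ≤ e ∧ e ≤ |e| := ⟨neg_abs_le e, le_abs_self e⟩
  have hm : 8 ≤ x + e := by nlinarith
  have hsucc := summand_succ q d s k
  have hs1 := summand_shift_s q d s k
  have hs2 := summand_shift_s q d (s + 1) k
  rw [show s + 1 + 1 = s + 2 by ring] at hs2
  rw [hs2] at hs1
  push_cast at hs1
  set X := summand q d (s + 2) k
  have hX := abs_nonneg X
  have e1 : |summand q d s k| = (2 * (x + e) + s + 1) * (2 * (x + e) + (s + 1) + 1) * |X| := by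
    rw [hs1, abs_mul, abs_mul, abs_of_pos, abs_of_pos]
    · ring
    · linarith
    · linarith
  have e2 : (x + 1) * |summand q d s (k + 1)| =
      4 * (x - q + 1 / 2) * (x + e + 1 / 2) ^ 2 * |X| := by
    have := congrArg abs hsucc
    rw [abs_mul, abs_mul _ X, abs_of_pos (by linarith : (0 : ℝ) < x + 1),
      abs_of_nonneg (a := 4 * (x - q + 1 / 2) * (x + e + 1 / 2) ^ 2)] at this
    · exact this
    · have : 0 ≤ x - q := by nlinarith
      positivity
  -- The worst case `q = 0`, `s = 1`; the general inequality follows by monotonicity in `q` and `s`.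
  have hpoly : x * (4 * (x + 1 / 2) * (x + e + 1 / 2) ^ 2) ≤
      (x + 1) * ((x - 3 / 2) * ((2 * (x + e) + 2) * (2 * (x + e) + 3))) := by
    have h1 : 6 ≤ x / 2 - e := by nlinarith
    have hy2 : x + e ≤ 2 * x := by nlinarith
    have h2 := mul_le_mul_of_nonneg_left h1 (by nlinarith : 0 ≤ x * (x + e))
    have h3 := mul_le_mul_of_nonneg_right hy2 (by linarith : 0 ≤ x + e)
    have h4 : 16 * (x + e) ≤ x * (x + e) := by gcongr
    have h5 : 16 * x ≤ x * x := by gcongr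
    nlinarith
  have hbig : x * (4 * (x - q + 1 / 2) * (x + e + 1 / 2) ^ 2) ≤
      (x + 1) * ((x - 3 / 2) * ((2 * (x + e) + s + 1) * (2 * (x + e) + (s + 1) + 1))) := by
    refine le_trans ?_ (hpoly.trans ?_)
    · gcongr; linarith
    · refine mul_le_mul_of_nonneg_left (mul_le_mul_of_nonneg_left
        (mul_le_mul ?_ ?_ ?_ ?_) ?_) ?_ <;> linarith
  have := mul_le_mul_of_nonneg_right hbig hX
  have hx1 : 0 < x + 1 := by linarith
  refine le_of_mul_le_mul_left ?_ hx1
  rw [e1]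
  calc _ = x * ((x + 1) * |summand q d s (k + 1)|) := by ring
    _ = _ := by rw [e2]
    _ ≤ _ := by linarith

/-- For `q ≥ 1` there is one power of `k` to spare, and lowering `q` by one absorbs the linear
factor. -/
theorem summable_linear_mul_summand {q d s : ℤ} (hq : 1 ≤ q) (hs : 1 ≤ s) (a b : ℝ) :
    Summable fun k : ℕ => (a * k + b) * summand q d s k := by
  have h1 := (summable_summand (q := q - 1) (d := d) (by omega) hs).mul_left a
  have h2 := (summable_summand (d := d) (by omega : 0 ≤ q) hs).mul_left (b + a * (q - 1 / 2))
  refine (h1.add h2).congr fun k => ?_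
  rw [summand_shift_q]; ring

/-! ### Recurrence and contiguous relations for the series -/

/-- The series giving the minimal solution of the three-term recurrence. -/
noncomputable def series (q d s : ℤ) : ℝ := ∑' k : ℕ, summand q d s k

theorem hasSum_series {q d s : ℤ} (hq : 0 ≤ q) (hs : 1 ≤ s) :
    HasSum (summand q d s) (series q d s) :=
  (summable_summand hq hs).hasSum

theorem series_recurrence {q d n : ℤ} (hq : 0 ≤ q) (hn : 1 ≤ n) :
    ((n : ℝ) + 1) ^ 2 * (n + 1 + 2 * (q + d)) * series q d (n + 2) -
      ((n + 1) ^ 2 * (n + 1 + 2 * (q + d)) - n ^ 2 * (n + 2 * (q + d))) * series q d (n + 1) +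
      2 * (n + q) * series q d n = 0 := by
  have H := (((hasSum_series (d := d) hq (by omega : 1 ≤ n + 2)).mul_left
    (((n : ℝ) + 1) ^ 2 * (n + 1 + 2 * (q + d)))).sub
    ((hasSum_series (d := d) hq (by omega : 1 ≤ n + 1)).mul_left
    (((n : ℝ) + 1) ^ 2 * (n + 1 + 2 * (q + d)) - n ^ 2 * (n + 2 * (q + d))))).add
    ((hasSum_series (d := d) hq hn).mul_left (2 * ((n : ℝ) + q)))
  -- Zeilberger certificate: the combination of terms is the difference of `-2 k * summand q d n k`
  -- in `k`.
  refine HasSum.eq_zero_of_telescope H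
    ((summable_summand (d := d) hq hn).mul_left (-2)) fun k => ?_
  have h1 := summand_shift_s q d n k
  have h2 := summand_shift_s q d (n + 1) k
  rw [show n + 1 + 1 = n + 2 by ring] at h2
  have h3 := summand_succ q d n k
  rw [h1, h2]
  push_cast at *
  linear_combination 2 * h3

/-- With `p = q + d`, this moves `p` to `p + 1` at fixed `q`; `series_diff_shift_q` moves `p` and
`q` together. Both are first order, which is what makes the difference usable as a normalization. -/
theorem series_diff_shift_d {q d : ℤ} (hq : 0 ≤ q) :
    2 * (1 + 2 * ((q : ℝ) + d + 1)) * (series q (d + 1) 1 - series q (d + 1) 2) =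
      (d + 1 / 2) * (series q d 1 - series q d 2) := by
  have S (e s : ℤ) (hs : 1 ≤ s) := hasSum_series (d := e) hq hs
  rw [← sub_eq_zero]
  refine HasSum.eq_zero_of_telescope
    ((((S (d + 1) 1 le_rfl).sub (S (d + 1) 2 (by omega))).mul_left _).sub
      (((S d 1 le_rfl).sub (S d 2 (by omega))).mul_left _))
    (((S d 2 (by omega)).sub (S d 1 le_rfl)).summable) fun k => ?_
  have h1 := summand_shift_s q d 1 k
  have h2 := summand_shift_s q d 2 k
  have h3 := summand_shift_s q d 3 k
  have h4 := summand_shift_d q d 1 k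
  have h5 := summand_shift_d q d 2 k
  have h6 := summand_succ q d 1 k
  have h7 := summand_succ q d 2 k
  norm_num at h1 h2 h3 h4 h5 h6 h7 ⊢
  rw [h3] at h6
  rw [h4, h5, h1, h2, h3]
  linear_combination h6 - h7

theorem series_diff_shift_q {q d : ℤ} (hq : 1 ≤ q) :
    (1 / 2 - q) * (1 + 2 * ((q : ℝ) + d)) * (series q d 1 - series q d 2) =
      2 * q * (series (q - 1) d 1 - series (q - 1) d 2) := by
  have S (s : ℤ) (hs : 1 ≤ s) := hasSum_series (d := d) (by omega : 0 ≤ q) hs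
  have S' (s : ℤ) (hs : 1 ≤ s) := hasSum_series (d := d) (by omega : 0 ≤ q - 1) hs
  rw [← sub_eq_zero]
  -- The certificate has `s = 0`, outside the range of `summable_summand`; `q ≥ 1` compensates.
  have hsum : Summable (summand q d 0) := by
    refine (summable_linear_mul_summand (d := d) hq le_rfl 2 (2 * d + 1)).congr fun k => ?_
    rw [summand_shift_s q d 0]; push_cast; ring_nf
  refine HasSum.eq_zero_of_telescope
    ((((S 1 le_rfl).sub (S 2 (by omega))).mul_left _).sub
      (((S' 1 le_rfl).sub (S' 2 (by omega))).mul_left _)) hsum fun k => ?_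
  have h0 := summand_shift_s q d 0 k
  have h1 := summand_shift_s q d 1 k
  have h4 := summand_shift_q q d 1 k
  have h5 := summand_shift_q q d 2 k
  have h6 := summand_succ q d 0 k
  norm_num at h0 h1 h4 h5 h6 ⊢
  rw [h6, h4, h5, h0, h1]
  ring

theorem series_contiguous_d {q d : ℤ} (hq : 1 ≤ q) :
    ((q : ℝ) + d + 1) * (4 * (q + d + 1) - 2) * series q (d + 1) 1 =
      (d + 1 / 2) ^ 2 * series q d 1 - 4 * q * series (q - 1) (d + 1) 1 := by
  have S (e : ℤ) := hasSum_series (d := e) (by omega : 0 ≤ q) (le_refl 1)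
  have S' := hasSum_series (d := d + 1) (by omega : 0 ≤ q - 1) (le_refl 1)
  rw [← sub_eq_zero]
  refine HasSum.eq_zero_of_telescope (((S (d + 1)).mul_left _).sub
      (((S d).mul_left _).sub (S'.mul_left _)))
      (summable_linear_mul_summand (d := d) hq le_rfl (-1) (-2 * d - 1)) fun k => ?_
  have h1 := summand_shift_s q d 1 k
  have h2 := summand_shift_s q d 2 k
  have h4 := summand_shift_q q (d + 1) 1 k
  have h5 := summand_shift_d q d 1 k
  have h6 := summand_succ q d 1 k
  norm_num at h1 h2 h4 h5 h6 ⊢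
  rw [h4, h5, h1, h2]
  linear_combination ((k : ℝ) + 2 * d + 2) * h6

theorem series_contiguous_q {q d : ℤ} (hq : 1 ≤ q) :
    (1 / 2 - (q : ℝ)) * series q d 1 = series (q - 1) d 1 - 4 * series (q - 1) (d + 1) 1 := by
  have S := hasSum_series (d := d) (by omega : 0 ≤ q) (le_refl 1)
  have S' (e : ℤ) := hasSum_series (d := e) (by omega : 0 ≤ q - 1) (le_refl 1)
  rw [← sub_eq_zero]
  refine HasSum.eq_zero_of_telescope ((S.mul_left _).sub
      ((S' d).sub ((S' (d + 1)).mul_left _))) S.summable fun k => ?_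
  have h1 := summand_shift_s q d 1 k
  have h2 := summand_shift_s q d 2 k
  have h3 := summand_shift_q q d 1 k
  have h4 := summand_shift_q q (d + 1) 1 k
  have h5 := summand_shift_d q d 1 k
  have h6 := summand_succ q d 1 k
  norm_num at h1 h2 h3 h4 h5 h6 ⊢
  rw [h6, h4, h5, h3, h1, h2]
  ring

/-- At `q = 0` the contiguous relations would call for `q - 1 = -1`, where the terms decay only like
`1/k`. The difference of series takes the place of that term, and becomes an explicit constant after
normalization. -/
theorem series_zero_left (d : ℤ) :
    4 * ((d : ℝ) + 1) * series 0 (d + 1) 1 =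
      (d + 1 / 2) * series 0 d 1 - (series 0 d 1 - series 0 d 2) / 2 := by
  have S (e s : ℤ) (hs : 1 ≤ s) := hasSum_series (d := e) (le_refl 0) hs
  rw [← sub_eq_zero]
  refine HasSum.eq_zero_of_telescope (((S (d + 1) 1 le_rfl).mul_left _).sub
      (((S d 1 le_rfl).mul_left _).sub
        (((S d 1 le_rfl).sub (S d 2 (by omega))).div_const 2)))
      (S d 1 le_rfl).summable.neg fun k => ?_
  have h1 := summand_shift_s 0 d 1 k
  have h2 := summand_shift_s 0 d 2 k
  have h5 := summand_shift_d 0 d 1 k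
  have h6 := summand_succ 0 d 1 k
  norm_num at h1 h2 h5 h6 ⊢
  rw [h6, h5, h1, h2]
  ring

/-- The boundary `d = -q`, that is `p = 0`; after normalization it mirrors `series_zero_left`. -/
theorem series_zero_right {q : ℤ} (hq : 1 ≤ q) :
    (q : ℝ) * (2 * q - 1) * series q (-q) 1 =
      8 * q * series (q - 1) (-q + 1) 1 - (series q (-q) 1 - series q (-q) 2) / 2 := by
  have S (s : ℤ) (hs : 1 ≤ s) := hasSum_series (d := -q) (by omega : 0 ≤ q) hs
  have S' := hasSum_series (d := -q + 1) (by omega : 0 ≤ q - 1) (le_refl 1)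
  rw [← sub_eq_zero]
  refine HasSum.eq_zero_of_telescope (((S 1 le_rfl).mul_left _).sub
      ((S'.mul_left _).sub (((S 1 le_rfl).sub (S 2 (by omega))).div_const 2)))
      (summable_linear_mul_summand (d := -q) hq le_rfl 2 (1 - 4 * q)) fun k => ?_
  have h1 := summand_shift_s q (-q) 1 k
  have h2 := summand_shift_s q (-q) 2 k
  have h4 := summand_shift_q q (-q + 1) 1 k
  have h5 := summand_shift_d q (-q) 1 k
  have h6 := summand_succ q (-q) 1 k
  norm_num at h1 h2 h4 h5 h6 ⊢
  rw [h4, h5, h1, h2]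
  linear_combination (4 * q - 2 * (k : ℝ) - 3) * h6

/-! ### The normalizing constant -/

/-- The normalizing constant relating the value of the series to that of the continued fraction. -/
noncomputable def normConst (p q : ℕ) : ℝ :=
  (1 + 2 * p) * (series q (p - q) 1 - series q (p - q) 2)

/-- The value of `H (2 * p) 0 q`, expressed through series. -/
noncomputable def seriesRatio (p q : ℕ) : ℝ := series q (p - q) 1 / normConst p q

theorem normConst_succ_left (p q : ℕ) :
    2 * (1 + 2 * (p : ℝ)) * normConst (p + 1) q = (p - q + 1 / 2) * normConst p q := by
  have h := series_diff_shift_d (q := q) (d := (p : ℤ) - q) (by omega)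
  unfold normConst
  rw [show ((p + 1 : ℕ) : ℤ) - q = p - q + 1 by push_cast; ring]
  push_cast at h ⊢
  linear_combination (1 + 2 * (p : ℝ)) * h

theorem normConst_succ_succ (p q : ℕ) :
    -(q + 1 / 2) * (1 + 2 * (p : ℝ)) * normConst (p + 1) (q + 1) =
      2 * (q + 1) * normConst p q := by
  have h := series_diff_shift_q (q := q + 1) (d := (p : ℤ) - q) (by omega)
  unfold normConst
  rw [show ((p + 1 : ℕ) : ℤ) - (q + 1 : ℕ) = p - q by push_cast; ring]
  rw [show (q : ℤ) + 1 - 1 = q by ring] at h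
  push_cast at h ⊢
  linear_combination (1 + 2 * (p : ℝ)) * h

theorem normConst_succ_right (p q : ℕ) :
    -(q + 1 / 2) * (p - q - 1 / 2) * normConst p (q + 1) = 4 * (q + 1) * normConst p q := by
  have h1 := normConst_succ_left p (q + 1)
  have h2 := normConst_succ_succ p q
  push_cast at h1
  linear_combination 2 * h2 + (q + 1 / 2) * h1

theorem normConst_zero_zero_pos : 0 < normConst 0 0 := by
  have S (s : ℤ) (hs : 1 ≤ s) := hasSum_series (d := 0) (le_refl 0) hs
  have hterm (k : ℕ) : 0 < summand 0 0 1 k - summand 0 0 2 k := by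
    have h := summand_shift_s 0 0 1 k
    have hpos : 0 < summand 0 0 2 k := by
      have h1 := halfGamma_pos k
      have h2 := invFact_pos (j := k) (by omega)
      have h3 := invFact_pos (j := 2 * k + 2) (by omega)
      simp only [summand, sub_zero, add_zero]
      positivity
    norm_num at h
    rw [h]
    have : (0 : ℝ) ≤ k := by positivity
    nlinarith
  have hs := (S 1 le_rfl).sub (S 2 (by omega))
  have := hs.summable.tsum_pos (fun k => (hterm k).le) 0 (hterm 0)
  rw [hs.tsum_eq] at this
  simpa [normConst] using this

/-- The first-order relations carry nonvanishing over from `(0, 0)`, where the defining series has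
positive terms. -/
theorem normConst_ne_zero (p q : ℕ) : normConst p q ≠ 0 := by
  induction q generalizing p with
  | zero =>
    induction p with
    | zero => exact normConst_zero_zero_pos.ne'
    | succ p ih =>
      intro h
      have := normConst_succ_left p 0
      rw [h, mul_zero, eq_comm, mul_eq_zero] at this
      refine this.elim (fun h => ?_) ih
      push_cast at h
      have : (0 : ℝ) ≤ p := by positivity
      linarith
  | succ q ih =>
    have h (p : ℕ) : normConst (p + 1) (q + 1) ≠ 0 := by
      intro h
      have := normConst_succ_succ p q
      rw [h, mul_zero, eq_comm, mul_eq_zero] at this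
      refine this.elim (fun h => ?_) (ih p)
      have : (0 : ℝ) ≤ q := by positivity
      linarith
    cases p with
    | zero =>
      intro h0
      -- The diagonal relation does not reach `p = 0`, so a zero there is pushed to `(1, q + 1)`,
      -- already excluded.
      have := normConst_succ_left 0 (q + 1)
      rw [h0, mul_zero] at this
      norm_num at this
      exact h 0 this
    | succ p => exact h p


/-! ### Symmetry of the normalized ratio -/

theorem seriesRatio_contiguous_left (p q : ℕ) :
    ((p : ℝ) + 1) * seriesRatio (p + 1) (q + 1) =
      (p - q - 1 / 2) * seriesRatio p (q + 1) + (q + 1 / 2) * seriesRatio p q := by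
  have h := series_contiguous_d (q := q + 1) (d := (p : ℤ) - (q + 1)) (by omega)
  have c0 := normConst_ne_zero p q
  have c1 := normConst_ne_zero (p + 1) (q + 1)
  have c2 := normConst_ne_zero p (q + 1)
  have e1 := normConst_succ_succ p q
  have e2 := normConst_succ_right p q
  unfold seriesRatio
  rw [show ((p + 1 : ℕ) : ℤ) - (q + 1 : ℕ) = p - q by push_cast; ring]
  rw [show (q : ℤ) + 1 - 1 = q by ring, show (p : ℤ) - (q + 1) + 1 = p - q by ring] at h
  push_cast at h ⊢
  set X := series (q + 1) (p - q) 1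
  set Y := series (q + 1) (p - (q + 1)) 1
  set Z := series q (p - q) 1
  have hq : (q : ℝ) + 1 ≠ 0 := by positivity
  have i1 : X / normConst (p + 1) (q + 1) =
      -(q + 1 / 2) * (1 + 2 * (p : ℝ)) * X / (2 * (q + 1) * normConst p q) := by
    rw [div_eq_div_iff c1 (by positivity)]
    linear_combination -X * e1
  have i2 : Y / normConst p (q + 1) =
      -(q + 1 / 2) * (p - q - 1 / 2) * Y / (4 * (q + 1) * normConst p q) := by
    rw [div_eq_div_iff c2 (by positivity)]
    linear_combination -Y * e2
  rw [i1, i2]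
  field_simp
  linear_combination -4 * h

theorem seriesRatio_contiguous_right (p q : ℕ) :
    ((q : ℝ) + 1) * seriesRatio (p + 1) (q + 1) =
      (q - p - 1 / 2) * seriesRatio (p + 1) q + (p + 1 / 2) * seriesRatio p q := by
  have h := series_contiguous_q (q := q + 1) (d := (p : ℤ) - q) (by omega)
  have c0 := normConst_ne_zero p q
  have c1 := normConst_ne_zero (p + 1) (q + 1)
  have c2 := normConst_ne_zero (p + 1) q
  have e1 := normConst_succ_succ p q
  have e2 := normConst_succ_left p q
  unfold seriesRatio
  rw [show ((p + 1 : ℕ) : ℤ) - (q + 1 : ℕ) = p - q by push_cast; ring,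
    show ((p + 1 : ℕ) : ℤ) - q = p - q + 1 by push_cast; ring]
  rw [show (q : ℤ) + 1 - 1 = q by ring] at h
  push_cast at h ⊢
  set X := series (q + 1) (p - q) 1
  set Y := series q (p - q + 1) 1
  set Z := series q (p - q) 1
  have hq : (q : ℝ) + 1 ≠ 0 := by positivity
  have hd : (p : ℝ) - q + 1 / 2 ≠ 0 := by
    have := half_int_ne_zero ((p : ℤ) - q)
    push_cast at this
    exact this
  have i1 : X / normConst (p + 1) (q + 1) =
      -(q + 1 / 2) * (1 + 2 * (p : ℝ)) * X / (2 * (q + 1) * normConst p q) := by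
    rw [div_eq_div_iff c1 (by positivity)]
    linear_combination -X * e1
  have i2 : (q - p - 1 / 2) * (Y / normConst (p + 1) q) =
      -(2 * (1 + 2 * (p : ℝ)) * Y / normConst p q) := by
    rw [← mul_div_assoc, ← neg_div, div_eq_div_iff c2 c0]
    linear_combination Y * e2
  rw [i1, i2]
  field_simp
  linear_combination (2 * (2 * (p : ℝ) + 1)) * h

theorem seriesRatio_succ_zero (p : ℕ) :
    ((p : ℝ) + 1) * seriesRatio (p + 1) 0 =
      (p + 1 / 2) * seriesRatio p 0 - 1 / (2 * (2 * p + 1)) := by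
  have h := series_zero_left p
  have c0 := normConst_ne_zero p 0
  have c1 := normConst_ne_zero (p + 1) 0
  have e := normConst_succ_left p 0
  have hn : normConst p 0 = (1 + 2 * p) * (series 0 p 1 - series 0 p 2) := by simp [normConst]
  unfold seriesRatio
  push_cast at h e ⊢
  simp only [sub_zero] at *
  have e' : normConst (p + 1) 0 = normConst p 0 / 4 := by
    have : (1 + 2 * (p : ℝ)) ≠ 0 := by positivity
    apply mul_left_cancel₀ this
    linear_combination e / 2
  rw [e']
  have : (2 * (p : ℝ) + 1) ≠ 0 := by positivity
  field_simp
  rw [hn]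
  linear_combination (2 * (2 * (p : ℝ) + 1)) * h

theorem seriesRatio_zero_succ (q : ℕ) :
    ((q : ℝ) + 1) * seriesRatio 0 (q + 1) =
      (q + 1 / 2) * seriesRatio 0 q - 1 / (2 * (2 * q + 1)) := by
  have h := series_zero_right (q := q + 1) (by omega)
  have c0 := normConst_ne_zero 0 q
  have c1 := normConst_ne_zero 0 (q + 1)
  have e := normConst_succ_right 0 q
  have hn : normConst 0 (q + 1) =
      series (q + 1) (-(q + 1)) 1 - series (q + 1) (-(q + 1)) 2 := by simp [normConst]
  rw [show (q : ℤ) + 1 - 1 = q by ring, show -((q : ℤ) + 1) + 1 = -q by ring, ← hn] at h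
  unfold seriesRatio
  push_cast at h e ⊢
  simp only [zero_sub] at *
  set X := series (q + 1) (-(q + 1)) 1
  set Y := series q (-q) 1
  have hq : (2 * (q : ℝ) + 1) ≠ 0 := by positivity
  have e' : normConst 0 q = (2 * q + 1) ^ 2 * normConst 0 (q + 1) / (16 * (q + 1)) := by
    rw [eq_div_iff (by positivity)]
    linear_combination -4 * e
  rw [e']
  field_simp
  linear_combination 2 * h

/-- Swapping `p` and `q` exchanges the left and right contiguous relations, and the boundary
recurrences on `q = 0` and `p = 0` coincide. -/
theorem seriesRatio_comm (p q : ℕ) : seriesRatio p q = seriesRatio q p := by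
  have hzero (p : ℕ) : seriesRatio p 0 = seriesRatio 0 p := by
    induction p with
    | zero => rfl
    | succ p ih =>
      have h1 := seriesRatio_succ_zero p
      have h2 := seriesRatio_zero_succ p
      refine mul_left_cancel₀ (by positivity : (p : ℝ) + 1 ≠ 0) ?_
      rw [h1, h2, ih]
  induction hn : p + q using Nat.strong_induction_on generalizing p q with
  | _ n ih =>
    rcases p with _ | p
    · exact (hzero q).symm
    rcases q with _ | q
    · exact hzero _
    refine mul_left_cancel₀ (by positivity : (p : ℝ) + 1 ≠ 0) ?_
    rw [seriesRatio_contiguous_left p q, seriesRatio_contiguous_right q p,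
      ih _ (by omega) p (q + 1) rfl, ih _ (by omega) p q rfl]

/-! ### Asymptotics of the series in `s` -/

/-- Only the term `k = 0` survives: `(J+i)! / (J+i+2k)!` decreases in `i`, and tends to `0` for `k >
0`. Dominated convergence applies with the terms at `i = 0` as bound. -/
theorem tendsto_series_mul_factorial {q d s : ℤ} (hq : 0 ≤ q) (hs : 1 ≤ s) {J : ℕ}
    (hJ : (J : ℤ) = 2 * d + s) :
    Tendsto (fun i : ℕ => series q d (s + i) * ((J + i).factorial : ℝ)) atTop
      (𝓝 (halfGamma (-q) * halfGamma d ^ 2)) := by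
  set c : ℕ → ℝ := fun k => halfGamma (k - q) * halfGamma (k + d) ^ 2 * 4 ^ k * invFact k with hc
  have hterm (i k : ℕ) : summand q d (s + i) k * ((J + i).factorial : ℝ) =
      c k * (((J + i + 1).ascFactorial (2 * k) : ℕ) : ℝ)⁻¹ := by
    have h1 : 2 * ((k : ℤ) + d) + (s + i) = ((J + i + 2 * k : ℕ) : ℤ) := by
      push_cast; rw [hJ]; ring
    have h2 : (((J + i + 2 * k).factorial : ℕ) : ℝ) =
        (J + i).factorial * ((J + i + 1).ascFactorial (2 * k) : ℕ) := by
      exact_mod_cast (Nat.factorial_mul_ascFactorial (J + i) (2 * k)).symm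
    have h3 : ((J + i).factorial : ℝ) ≠ 0 := by positivity
    have h4 : (((J + i + 1).ascFactorial (2 * k) : ℕ) : ℝ) ≠ 0 := by
      exact_mod_cast (Nat.ascFactorial_pos _ _).ne'
    simp only [summand, h1, invFact_natCast, h2, hc]
    field_simp
  have hlim := tendsto_tsum_of_dominated_convergence (𝓕 := atTop)
    (f := fun (i k : ℕ) => summand q d (s + i) k * ((J + i).factorial : ℝ))
    (g := fun k => if k = 0 then halfGamma (-q) * halfGamma d ^ 2 else 0)
    (bound := fun k => |summand q d s k * (J.factorial : ℝ)|)
    ((summable_summand hq hs).mul_right _).abs (fun k => ?_) ?_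
  · rw [tsum_ite_eq] at hlim
    refine hlim.congr fun i => ?_
    rw [tsum_mul_right, series]
  · simp only [hterm]
    split_ifs with hk
    · subst hk
      have h0 : invFact 0 = 1 := by simpa using invFact_natCast 0
      simp [hc, h0]
    · have : Tendsto (fun i : ℕ => (((J + i + 1).ascFactorial (2 * k) : ℕ) : ℝ)⁻¹) atTop (𝓝 0) := by
        refine tendsto_inv_atTop_zero.comp ?_
        refine tendsto_natCast_atTop_atTop.comp (tendsto_atTop_mono (fun i => ?_) tendsto_id)
        obtain ⟨m, hm⟩ : ∃ m, 2 * k = m + 1 := ⟨2 * k - 1, by omega⟩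
        have h := Nat.ascFactorial_pos (J + i) m
        rw [hm, Nat.ascFactorial_succ]
        simp only [id]
        nlinarith
      simpa using this.const_mul (c k)
  · refine Eventually.of_forall fun i k => ?_
    have h0 := hterm 0 k
    simp only [Nat.cast_zero, add_zero] at h0
    rw [h0, hterm, Real.norm_eq_abs, abs_mul (c k), abs_mul (c k)]
    refine mul_le_mul_of_nonneg_left ?_ (abs_nonneg _)
    rw [abs_of_nonneg (by positivity), abs_of_nonneg (by positivity)]
    have hpos : (0 : ℝ) < ((J + 1).ascFactorial (2 * k) : ℕ) := by
      exact_mod_cast Nat.ascFactorial_pos _ _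
    refine inv_anti₀ hpos ?_
    exact_mod_cast Nat.ascFactorial_le (2 * k) (by omega : J + 1 ≤ J + i + 1)

theorem tendsto_series_div_invFact {q : ℤ} (hq : 0 ≤ q) (d : ℤ) :
    Tendsto (fun n : ℕ => series q d n / invFact (2 * d + n)) atTop
      (𝓝 (halfGamma (-q) * halfGamma d ^ 2)) := by
  -- Beyond this shift `2d + n` is nonnegative, so `invFact` is a genuine reciprocal factorial; for
  -- small `n` the quotient may be a division by zero.
  set N := 2 * d.natAbs + 1 with hN
  rw [← tendsto_add_atTop_iff_nat N]
  have h := tendsto_series_mul_factorial (d := d) (s := N) (J := (2 * d + N).toNat) hq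
    (by omega) (by omega)
  refine h.congr fun i => ?_
  have : 2 * d + ((i + N : ℕ) : ℤ) = (((2 * d + N).toNat + i : ℕ) : ℤ) := by omega
  rw [this, invFact_natCast, div_inv_eq_mul]
  congr 2
  push_cast; ring

/-! ### Pincherle's theorem -/

/-- Eventually the increments grow in absolute value and keep their sign, so `r / δ N` grows at
least linearly. -/
theorem tendsto_inv_of_diff_ratio {r δ : ℕ → ℝ} (hr : ∀ n, r (n + 1) - r n = δ n)
    {ℓ : ℝ} (hℓ : 1 < ℓ) (hδ : ∀ᶠ n in atTop, δ n ≠ 0)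
    (h : Tendsto (fun n => δ (n + 1) / δ n) atTop (𝓝 ℓ)) :
    Tendsto (fun n => (r n)⁻¹) atTop (𝓝 0) ∧ ∀ᶠ n in atTop, r n ≠ 0 := by
  obtain ⟨N, hN⟩ := eventually_atTop.1 (hδ.and (h.eventually (lt_mem_nhds hℓ)))
  have hd (i : ℕ) : 1 ≤ δ (N + i) / δ N := by
    induction i with
    | zero => rw [add_zero, div_self (hN N le_rfl).1]
    | succ i ih =>
      have h1 := hN (N + i) (by omega)
      have : δ (N + (i + 1)) / δ N = δ (N + i + 1) / δ (N + i) * (δ (N + i) / δ N) := by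
        rw [div_mul_div_cancel₀ h1.1, add_assoc]
      rw [this]
      nlinarith [h1.2]
  have hsum (i : ℕ) : (i : ℝ) ≤ (r (N + i) - r N) / δ N := by
    induction i with
    | zero => simp
    | succ i ih =>
      have : (r (N + (i + 1)) - r N) / δ N = (r (N + i) - r N) / δ N + δ (N + i) / δ N := by
        rw [← add_div, ← hr (N + i), add_assoc]
        congr 1; ring
      rw [this]
      push_cast
      linarith [hd i]
  have hδN := (hN N le_rfl).1
  have htop : Tendsto (fun i : ℕ => r (i + N) / δ N) atTop atTop := by
    have h1 : Tendsto (fun i : ℕ => (i : ℝ) + r N / δ N) atTop atTop :=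
      tendsto_atTop_add_const_right _ _ tendsto_natCast_atTop_atTop
    refine tendsto_atTop_mono (fun i => ?_) h1
    have := hsum i
    rw [sub_div] at this
    rw [add_comm i N]
    linarith
  constructor
  · rw [← tendsto_add_atTop_iff_nat N]
    have h1 := (tendsto_inv_atTop_zero.comp htop).mul_const (δ N)⁻¹
    rw [zero_mul] at h1
    refine h1.congr fun i => ?_
    simp only [Function.comp, inv_div]
    field_simp
  · rw [← map_add_atTop_eq_nat N, eventually_map]
    filter_upwards [htop.eventually_gt_atTop 0] with i hi h0
    rw [h0, zero_div] at hi
    exact lt_irrefl _ hi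

/-- A solution of a three-term recurrence is dominated by the denominators of the corresponding
continued fraction when the associated Casoratian quotients have limit ratio larger than one. -/
theorem tendsto_div_of_casoratian {a b M D : ℕ → ℝ}
    (hM : ∀ n, M (n + 2) = a (n + 1) * M (n + 1) + b (n + 1) * M n)
    (hD0 : D 0 = 1) (hD1 : D 1 = a 1)
    (hD : ∀ n, D (n + 2) = a (n + 2) * D (n + 1) + b (n + 2) * D n)
    (hM0 : M 0 ≠ 0) (hb : ∀ n, b (n + 1) ≠ 0) (hMne : ∀ᶠ n in atTop, M n ≠ 0)
    {ℓ : ℝ} (hℓ : 1 < ℓ) (h : Tendsto (fun n => -b (n + 1) * M n / M (n + 2)) atTop (𝓝 ℓ)) :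
    Tendsto (fun n => M (n + 1) / D n) atTop (𝓝 0) ∧ ∀ᶠ n in atTop, D n ≠ 0 := by
  -- The shifted sequence `M (n+1)` obeys the same recurrence as `D n`, so their Casoratian is
  -- multiplied by `-b (n+2)` at each step and never vanishes.
  set W : ℕ → ℝ := fun n => D (n + 1) * M (n + 1) - D n * M (n + 2) with hW
  have hW0 : W 0 = -b 1 * M 0 := by
    simp only [hW, zero_add, hD0, hD1, hM 0]; ring
  have hWs (n : ℕ) : W (n + 1) = -b (n + 2) * W n := by
    simp only [hW, hD n]
    rw [hM (n + 1)]; ring_nf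
  have hWne (n : ℕ) : W n ≠ 0 := by
    induction n with
    | zero => rw [hW0]; exact mul_ne_zero (neg_ne_zero.2 (hb 0)) hM0
    | succ n ih => rw [hWs]; exact mul_ne_zero (neg_ne_zero.2 (hb (n + 1))) ih
  obtain ⟨N, hN⟩ := eventually_atTop.1 hMne
  -- The increments of `D n / M (n+1)` are `W n / (M (n+1) M (n+2))`; consecutive ones have ratio
  -- `-b (n+2) M (n+1) / M (n+3)`, which tends to `ℓ`.
  obtain ⟨h1, h2⟩ := tendsto_inv_of_diff_ratio
    (r := fun n => D (n + N) / M (n + N + 1))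
    (δ := fun n => W (n + N) / (M (n + N + 1) * M (n + N + 2))) (fun n => by
      have e1 := hN (n + N + 1) (by omega)
      have e2 := hN (n + N + 2) (by omega)
      simp only [hW]
      rw [show n + 1 + N = n + N + 1 by ring]
      field_simp) hℓ
    (Eventually.of_forall fun n => div_ne_zero (hWne _)
      (mul_ne_zero (hN _ (by omega)) (hN _ (by omega)))) (by
      have h' := (tendsto_add_atTop_iff_nat (N + 1)).2 h
      refine h'.congr fun n => ?_
      have e1 := hN (n + N + 1) (by omega)
      have e2 := hN (n + N + 2) (by omega)
      have e3 := hN (n + N + 3) (by omega)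
      have e4 := hWne (n + N)
      rw [show n + 1 + N = n + N + 1 by ring, show n + (N + 1) = n + N + 1 by ring, hWs]
      field_simp)
  constructor
  · rw [← tendsto_add_atTop_iff_nat N]
    refine h1.congr fun n => ?_
    rw [inv_div]
  · rw [← map_add_atTop_eq_nat N, eventually_map]
    filter_upwards [h2] with n hn h0
    exact hn (by rw [h0, zero_div])

theorem CF_get? (a b : ℕ → ℂ) (n : ℕ) : (CF a b).s.get? n = some ⟨b (n + 1), a (n + 1)⟩ := rfl

/-- The denominators of the convergents of a continued fraction with real coefficients. -/
def realDens (a b : ℕ → ℝ) : ℕ → ℝ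
  | 0 => 1
  | 1 => a 1
  | n + 2 => a (n + 2) * realDens a b (n + 1) + b (n + 2) * realDens a b n

theorem CF_dens (a b : ℕ → ℝ) (n : ℕ) :
    (CF (fun n => (a n : ℂ)) (fun n => (b n : ℂ))).dens n = (realDens a b n : ℂ) := by
  induction n using Nat.twoStepInduction with
  | zero => simp [realDens]
  | one => rw [GenContFract.first_den_eq (CF_get? _ _ 0)]; simp [realDens]
  | more n h1 h2 =>
    rw [GenContFract.dens_recurrence (CF_get? _ _ (n + 1)) h1 h2]
    simp [realDens]

/-- The solution space is two-dimensional, so the numerators combine `M (n+1)` and the denominators,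
with coefficients fixed by the first two values. Dividing by the denominators leaves the limit `(a 0
* M 0 - M 1) / M 0` once `M (n+1) / D n → 0`. -/
theorem CF_nums {a b M : ℕ → ℝ}
    (hM : ∀ n, M (n + 2) = a (n + 1) * M (n + 1) + b (n + 1) * M n) (n : ℕ) :
    (M 0 : ℂ) * (CF (fun n => (a n : ℂ)) (fun n => (b n : ℂ))).nums n =
      M (n + 1) + (a 0 * M 0 - M 1) * (realDens a b n : ℂ) := by
  induction n using Nat.twoStepInduction with
  | zero => simp [realDens, CF]; ring
  | one =>
    rw [GenContFract.first_num_eq (CF_get? _ _ 0), hM 0]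
    simp [realDens, CF]; ring
  | more n h1 h2 =>
    rw [GenContFract.nums_recurrence (CF_get? _ _ (n + 1)) rfl rfl, hM (n + 1)]
    simp only [realDens, Complex.ofReal_add, Complex.ofReal_mul]
    linear_combination (a (n + 2) : ℂ) * h2 + (b (n + 2) : ℂ) * h1

/-- A version of Pincherle's theorem. -/
theorem CF_convergesTo {a b M : ℕ → ℝ}
    (hM : ∀ n, M (n + 2) = a (n + 1) * M (n + 1) + b (n + 1) * M n)
    (hM0 : M 0 ≠ 0) (hb : ∀ n, b (n + 1) ≠ 0) (hMne : ∀ᶠ n in atTop, M n ≠ 0)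
    {ℓ : ℝ} (hℓ : 1 < ℓ) (h : Tendsto (fun n => -b (n + 1) * M n / M (n + 2)) atTop (𝓝 ℓ)) :
    ConvergesTo (CF (fun n => (a n : ℂ)) (fun n => (b n : ℂ)))
      (((a 0 * M 0 - M 1) / M 0 : ℝ) : ℂ) := by
  obtain ⟨h1, h2⟩ := tendsto_div_of_casoratian (D := realDens a b) hM rfl rfl (fun _ => rfl)
    hM0 hb hMne hℓ h
  have h2' : ∀ᶠ n in atTop, (CF (fun n => (a n : ℂ)) (fun n => (b n : ℂ))).dens n ≠ 0 := by
    filter_upwards [h2] with n hn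
    rw [CF_dens]
    exact_mod_cast hn
  refine ⟨h2', ?_⟩
  have h3 : Tendsto (fun n => (M (n + 1) / realDens a b n + (a 0 * M 0 - M 1)) / M 0) atTop
      (𝓝 ((a 0 * M 0 - M 1) / M 0)) := by
    simpa using (h1.add_const (a 0 * M 0 - M 1)).div_const (M 0)
  refine ((Complex.continuous_ofReal.tendsto _).comp h3).congr' ?_
  filter_upwards [h2] with n hn
  have hn' : (realDens a b n : ℂ) ≠ 0 := by exact_mod_cast hn
  have hM0' : (M 0 : ℂ) ≠ 0 := by exact_mod_cast hM0
  rw [GenContFract.conv_eq_num_div_den, CF_dens, Function.comp, eq_div_iff hn']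
  refine mul_left_cancel₀ hM0' ?_
  rw [CF_nums hM]
  push_cast
  field_simp

/-! ### The minimal solution for `cfH` -/

/-- The minimal solution of the recurrence satisfied by the numerators and denominators. -/
noncomputable def minimalSol (p q n : ℕ) : ℝ :=
  (n.factorial : ℝ) ^ 2 * (n + 2 * p).factorial * series q (p - q) (n + 1)

/-- The partial denominators of the continued fraction. -/
def coeffA (p n : ℕ) : ℝ := ((n : ℝ) + 1) ^ 2 * (n + 1 + 2 * p) - n ^ 2 * (n + 2 * p)

/-- The partial numerators of the continued fraction. -/
def coeffB (p q n : ℕ) : ℝ := -2 * (n : ℝ) ^ 2 * (n + 2 * p) * (n + q)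

theorem cfH_eq (p q : ℕ) :
    cfH (2 * p) 0 q = CF (fun n => (coeffA p n : ℂ)) (fun n => (coeffB p q n : ℂ)) := by
  unfold cfH coeffA coeffB
  congr 1
  · funext n
    simp only [fwdDiff]
    push_cast; ring
  · funext n
    push_cast; ring

theorem series_recurrence_nat (p q n : ℕ) :
    ((n : ℝ) + 2) ^ 2 * (n + 2 + 2 * p) * series q (p - q) (n + 3) -
      coeffA p (n + 1) * series q (p - q) (n + 2) +
      2 * (n + 1 + q) * series q (p - q) (n + 1) = 0 := by
  have h := series_recurrence (q := q) (d := (p : ℤ) - q) (n := n + 1) (by omega) (by omega)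
  rw [show (n : ℤ) + 1 + 2 = n + 3 by ring, show (n : ℤ) + 1 + 1 = n + 2 by ring] at h
  unfold coeffA
  push_cast at h ⊢
  linear_combination h

theorem minimalSol_recurrence (p q n : ℕ) :
    minimalSol p q (n + 2) =
      coeffA p (n + 1) * minimalSol p q (n + 1) + coeffB p q (n + 1) * minimalSol p q n := by
  have h := series_recurrence_nat p q n
  unfold minimalSol coeffB
  rw [show n + 2 + 2 * p = n + 2 * p + 1 + 1 by ring, show n + 1 + 2 * p = n + 2 * p + 1 by ring]
  simp only [Nat.factorial_succ]
  push_cast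
  rw [show (n : ℤ) + 2 + 1 = n + 3 by ring, show (n : ℤ) + 1 + 1 = n + 2 by ring]
  linear_combination ((n : ℝ) + 1) ^ 2 * (n.factorial : ℝ) ^ 2 * ((n : ℝ) + 2 * p + 1) *
    (n + 2 * p).factorial * h

theorem series_leading_ne_zero (q d : ℤ) : halfGamma (-q) * halfGamma d ^ 2 ≠ 0 :=
  mul_ne_zero (halfGamma_ne_zero _) (pow_ne_zero _ (halfGamma_ne_zero _))

theorem eventually_minimalSol_ne_zero (p q : ℕ) : ∀ᶠ n in atTop, minimalSol p q n ≠ 0 := by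
  have h := ((tendsto_add_atTop_iff_nat 1).2 (tendsto_series_div_invFact (q := q) (by omega)
    ((p : ℤ) - q))).eventually_ne (series_leading_ne_zero _ _)
  filter_upwards [h] with n hn h0
  refine hn ?_
  unfold minimalSol at h0
  have : series q (p - q) (n + 1) = 0 := by
    simpa [Nat.factorial_ne_zero] using h0
  push_cast
  rw [this, zero_div]

theorem tendsto_add_div_add (a b : ℝ) :
    Tendsto (fun n : ℕ => ((n : ℝ) + a) / (n + b)) atTop (𝓝 1) := by
  have h := tendsto_natCast_atTop_atTop (R := ℝ)
  have h1 : Tendsto (fun n : ℕ => 1 + (a - b) / ((n : ℝ) + b)) atTop (𝓝 (1 + 0)) :=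
    ((tendsto_const_nhds (x := a - b)).div_atTop
      (tendsto_atTop_add_const_right _ b h)).const_add 1
  rw [add_zero] at h1
  refine h1.congr' ?_
  filter_upwards [h.eventually_gt_atTop (-b)] with n hn
  have : (n : ℝ) + b ≠ 0 := by linarith
  field_simp
  ring

/-- After cancelling factorials the quotient is `2 (n+1+q) S(n+1) / ((n+2)² (n+2+2p) S(n+3))`. Since
`S(n)` is asymptotic to a constant over `(2d+n)!`, the ratio `S(n+1)/S(n+3)` is asymptotic to `n²`.
-/
theorem tendsto_minimalSol_ratio (p q : ℕ) :
    Tendsto (fun n => -coeffB p q (n + 1) * minimalSol p q n / minimalSol p q (n + 2)) atTop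
      (𝓝 2) := by
  set d : ℤ := p - q with hd
  have hψ := tendsto_series_div_invFact (q := q) (by omega) d
  have hne := series_leading_ne_zero q d
  have h1 := (tendsto_add_atTop_iff_nat 1).2 hψ
  have h3 := (tendsto_add_atTop_iff_nat 3).2 hψ
  have hmain := ((((h1.div h3 hne).const_mul 2).mul (tendsto_add_div_add (1 + q) 2)).mul
    (tendsto_add_div_add (2 * d + 2) 2)).mul (tendsto_add_div_add (2 * d + 3) (2 + 2 * p))
  rw [div_self hne, mul_one, mul_one, mul_one, mul_one] at hmain
  refine hmain.congr' ?_
  filter_upwards [h3.eventually_ne hne, eventually_ge_atTop (2 * d.natAbs)] with n hn hnd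
  have hI : invFact (2 * d + (n + 3 : ℕ)) ≠ 0 := (invFact_pos (by omega)).ne'
  have hI1 : invFact (2 * d + (n + 1 : ℕ)) =
      (n + (2 * d + 2)) * (n + (2 * d + 3)) * invFact (2 * d + (n + 3 : ℕ)) := by
    rw [invFact_eq, invFact_eq (2 * d + (n + 1 : ℕ) + 1),
      show 2 * d + ((n + 1 : ℕ) : ℤ) + 1 + 1 = 2 * d + (n + 3 : ℕ) by push_cast; ring]
    push_cast; ring
  have hS3 : series q d (n + 3 : ℕ) ≠ 0 := fun h0 => hn (by rw [h0, zero_div])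
  have hd2 : (n : ℝ) + (2 * d + 2) ≠ 0 := by
    have : (n : ℤ) + (2 * d + 2) ≠ 0 := by omega
    exact_mod_cast this
  have hd3 : (n : ℝ) + (2 * d + 3) ≠ 0 := by
    have : (n : ℤ) + (2 * d + 3) ≠ 0 := by omega
    exact_mod_cast this
  simp only [Pi.div_apply, hI1]
  generalize invFact (2 * d + (n + 3 : ℕ)) = I at hI
  unfold coeffB minimalSol
  rw [← hd, show n + 2 + 2 * p = n + 2 * p + 1 + 1 by ring]
  simp only [Nat.factorial_succ]
  push_cast at hS3 ⊢
  rw [show (n : ℤ) + 2 + 1 = n + 3 by ring]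
  generalize (n : ℝ) + (2 * d + 2) = x at hd2 ⊢
  generalize (n : ℝ) + (2 * d + 3) = y at hd3 ⊢
  have f1 : (n.factorial : ℝ) ≠ 0 := by positivity
  have f2 : ((n + 2 * p).factorial : ℝ) ≠ 0 := by positivity
  have f3 : (n : ℝ) + 1 ≠ 0 := by positivity
  have f4 : (n : ℝ) + 2 ≠ 0 := by positivity
  have f5 : (n : ℝ) + (2 + 2 * p) ≠ 0 := by positivity
  have f6 : (n : ℝ) + 2 * p + 1 ≠ 0 := by positivity
  have f7 : (n : ℝ) + 2 * p + 1 + 1 ≠ 0 := by positivity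
  have f8 : (n : ℝ) + 1 + 1 ≠ 0 := by positivity
  field_simp
  ring

theorem minimalSol_connection (p q : ℕ) :
    coeffA p 0 * minimalSol p q 0 - minimalSol p q 1 = (2 * p).factorial * normConst p q := by
  unfold coeffA minimalSol normConst
  rw [show 1 + 2 * p = 2 * p + 1 by ring, zero_add, Nat.factorial_succ (2 * p)]
  norm_num
  ring

/-! ### Nonvanishing of the series -/

/-- If `S(1) = 0`, then `w n = n! S(n+1)` starts at `0` and moves away from it monotonically, since
`1 + 2p - 2q > 0` in its recurrence. But the asymptotics of the series force `w n → 0`. -/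
theorem series_ne_zero_of_le {p q : ℕ} (hqp : q ≤ p) : series q (p - q) 1 ≠ 0 := by
  intro h0
  set w : ℕ → ℝ := fun n => n.factorial * series q (p - q) (n + 1) with hw
  have hw0 : w 0 = 0 := by simp [hw, h0]
  have hw1 : w 1 ≠ 0 := by
    intro h1
    refine normConst_ne_zero p q ?_
    have : series q (p - q) 2 = 0 := by simpa [hw] using h1
    rw [normConst, h0, this]; ring
  have hrec (n : ℕ) : ((n : ℝ) + 2) * (n + 2 + 2 * p) * (w (n + 2) - w (n + 1)) =
      (n + 1) * ((2 * n + 3 + 2 * p) * (w (n + 1) - w n) + (1 + 2 * p - 2 * q) * w n) := by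
    have h := series_recurrence_nat p q n
    simp only [hw, Nat.factorial_succ, coeffA] at h ⊢
    push_cast at h ⊢
    rw [show (n : ℤ) + 2 + 1 = n + 3 by ring, show (n : ℤ) + 1 + 1 = n + 2 by ring]
    linear_combination ((n : ℝ) + 1) * n.factorial * h
  have hqp' : (q : ℝ) ≤ p := by exact_mod_cast hqp
  -- Multiplying by `w 1` makes the argument independent of its unknown sign.
  have hmono (n : ℕ) : 0 ≤ w 1 * w n ∧ w 1 * w n ≤ w 1 * w (n + 1) := by
    induction n with
    | zero =>
      rw [hw0, mul_zero, zero_add]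
      exact ⟨le_rfl, mul_self_nonneg _⟩
    | succ n ih =>
      refine ⟨ih.1.trans ih.2, ?_⟩
      have h1 : 0 ≤ ((n : ℝ) + 2) * (n + 2 + 2 * p) * (w 1 * w (n + 2) - w 1 * w (n + 1)) := by
        have : ((n : ℝ) + 2) * (n + 2 + 2 * p) * (w 1 * w (n + 2) - w 1 * w (n + 1)) =
            (n + 1) * ((2 * n + 3 + 2 * p) * (w 1 * w (n + 1) - w 1 * w n) +
              (1 + 2 * p - 2 * q) * (w 1 * w n)) := by
          linear_combination w 1 * hrec n
        rw [this]
        have i1 : 0 ≤ w 1 * w (n + 1) - w 1 * w n := by linarith [ih.2]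
        have i2 : 0 ≤ 1 + 2 * (p : ℝ) - 2 * q := by linarith
        have i3 := mul_nonneg i2 ih.1
        positivity
      have h2 := nonneg_of_mul_nonneg_right h1 (by positivity)
      linarith
  have hlow (n : ℕ) : w 1 * w 1 ≤ w 1 * w (n + 1) := by
    induction n with
    | zero => simp
    | succ n ih => exact ih.trans (hmono (n + 1)).2
  have hlim : Tendsto w atTop (𝓝 0) := by
    have h := (tendsto_add_atTop_iff_nat 1).2
      (tendsto_series_div_invFact (q := q) (by omega) ((p : ℤ) - q))
    have h2 : Tendsto (fun n : ℕ => (n.factorial : ℝ) * invFact (2 * ((p : ℤ) - q) + (n + 1 : ℕ)))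
        atTop (𝓝 0) := by
      refine squeeze_zero (fun n => mul_nonneg (by positivity) (invFact_nonneg _)) (fun n => ?_)
        (tendsto_one_div_add_atTop_nhds_zero_nat (𝕜 := ℝ))
      have e : 2 * ((p : ℤ) - q) + (n + 1 : ℕ) = ((2 * (p - q) + (n + 1) : ℕ) : ℤ) := by omega
      rw [e, invFact_natCast, ← div_eq_mul_inv, div_le_div_iff₀ (by positivity) (by positivity)]
      have := Nat.factorial_le (by omega : n + 1 ≤ 2 * (p - q) + (n + 1))
      rw [Nat.factorial_succ] at this
      have h' : ((n : ℝ) + 1) * n.factorial ≤ ((2 * (p - q) + (n + 1)).factorial : ℕ) := by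
        exact_mod_cast this
      linarith
    have h3 := h2.mul h
    rw [zero_mul] at h3
    refine h3.congr fun n => ?_
    have : invFact (2 * ((p : ℤ) - q) + (n + 1 : ℕ)) ≠ 0 := (invFact_pos (by omega)).ne'
    simp only [hw]
    field_simp
    push_cast
    rfl
  have hlim2 := ((tendsto_add_atTop_iff_nat 1).2 hlim).const_mul (w 1)
  rw [mul_zero] at hlim2
  have := ge_of_tendsto' hlim2 hlow
  exact absurd this (not_le.2 (mul_self_pos.2 hw1))

theorem series_ne_zero (p q : ℕ) : series q (p - q) 1 ≠ 0 := by
  rcases le_total q p with h | h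
  · exact series_ne_zero_of_le h
  · intro h0
    have h1 := seriesRatio_comm p q
    have h2 : seriesRatio q p ≠ 0 :=
      div_ne_zero (series_ne_zero_of_le h) (normConst_ne_zero q p)
    refine h2 ?_
    rw [← h1, seriesRatio, h0, zero_div]

theorem seriesRatio_ne_zero (p q : ℕ) : seriesRatio p q ≠ 0 :=
  div_ne_zero (series_ne_zero p q) (normConst_ne_zero p q)

/-! ### Value of the continued fraction and conclusion -/

theorem cfH_convergesTo (p q : ℕ) :
    ConvergesTo (cfH (2 * p) 0 q) (((seriesRatio p q)⁻¹ : ℝ) : ℂ) := by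
  have h0 : minimalSol p q 0 = (2 * p).factorial * series q (p - q) 1 := by simp [minimalSol]
  have hf : ((2 * p).factorial : ℝ) ≠ 0 := by positivity
  have h := CF_convergesTo (minimalSol_recurrence p q)
    (by rw [h0]; exact mul_ne_zero hf (series_ne_zero p q))
    (fun n => by
      unfold coeffB
      have h : (0 : ℝ) < 2 * ((n + 1 : ℕ) : ℝ) ^ 2 * ((n + 1 : ℕ) + 2 * p) * ((n + 1 : ℕ) + q) := by
        positivity
      exact ne_of_lt (by linarith))
    (eventually_minimalSol_ne_zero p q) one_lt_two (tendsto_minimalSol_ratio p q)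
  rw [minimalSol_connection, h0, mul_div_mul_left _ _ hf] at h
  rw [cfH_eq, seriesRatio, inv_div]
  exact h

theorem H_eq_seriesRatio (p q : ℕ) : H (2 * p) 0 q = (seriesRatio p q : ℂ) := by
  rw [H, (cfH_convergesTo p q).value_eq]
  push_cast
  rw [one_div, inv_inv]

end RamanujanCF

theorem theorem2p3 (p q : ℕ) :
    (∃ v : ℂ, v ≠ 0 ∧ RamanujanCF.ConvergesTo (RamanujanCF.cfH (2 * p) 0 q) v) ∧
    (∃ w : ℂ, w ≠ 0 ∧ RamanujanCF.ConvergesTo (RamanujanCF.cfH (2 * q) 0 p) w) ∧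
    RamanujanCF.H (2 * p) 0 q = RamanujanCF.H (2 * q) 0 p := by
  have hne (p q : ℕ) : (((RamanujanCF.seriesRatio p q)⁻¹ : ℝ) : ℂ) ≠ 0 := by
    exact_mod_cast inv_ne_zero (RamanujanCF.seriesRatio_ne_zero p q)
  refine ⟨⟨_, hne p q, RamanujanCF.cfH_convergesTo p q⟩,
    ⟨_, hne q p, RamanujanCF.cfH_convergesTo q p⟩, ?_⟩
  rw [RamanujanCF.H_eq_seriesRatio, RamanujanCF.H_eq_seriesRatio, RamanujanCF.seriesRatio_comm]
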